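/- Fix real parameters $C>0$, $\beta\in(0,1)$, $R>0$ (the CUBIC constants and the round trip time) and $p\in(0,1)$ (the packet loss probability). For integers $z\ge 1$, $d\ge 0$ let \[ w(z,d)=\max\Bigl\{1,\Bigl\lfloor C\bigl(Rd-\sqrt[3]{\beta z/C}\,\bigr)^3+z\Bigr\rfloor\Bigr\} \] be the TCP CUBIC window size (in packets) $d$ round trip times after a loss that occurred at window size $z$. Let $\{(W'_n(p),T_n(p))\}_{n\ge 0}$ be the Markov chain on the countable state space $\{1,2,\dots\}\times\{0,1,2,\dots\}$ (window size at the last loss epoch, number of round trip times since then) which from state $(z,d)$ moves to $(z,d+1)$ with probability $(1-p)^{w(z,d)}$ (no packet is lost) and to $(w(z,d),0)$ with probability $1-(1-p)^{w(z,d)}$. Then this chain has exactly one communicating class that is aperiodic and positive recurrent and all of whose complementary states are transient; the state $(1,0)$ is positive recurrent, so it belongs to that class. The chain has a unique stationary distribution. -/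

import Mathlib

open scoped ENNReal NNReal

/-! ## Time-homogeneous Markov chains on a discrete state space

A chain on `S` is given by its transition law: `P s` is the law of the next state from `s`. -/

namespace DiscreteChain

variable {S : Type*}

/-- `nStep P n s t` is the probability of being in `t` after `n` steps when starting in `s`. -/
noncomputable def nStep (P : S → PMF S) : ℕ → S → PMF S
  | 0, s => PMF.pure s
  | n + 1, s => (P s).bind (nStep P n)

open Classical in
/-- `firstPassage P t n s` is the probability that the chain started in `s` is in `t` at time `n`
and not at any of the times `1, …, n - 1` (and it is `0` for `n = 0`). -/
noncomputable def firstPassage (P : S → PMF S) (t : S) : ℕ → S → ℝ≥0∞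
  | 0, _ => 0
  | 1, s => P s t
  | n + 2, s => ∑' u, if u = t then 0 else P s u * firstPassage P t (n + 1) u

/-- The probability that the chain started in `s` ever returns to `s`. -/
noncomputable def returnProb (P : S → PMF S) (s : S) : ℝ≥0∞ :=
  ∑' n, firstPassage P s n s

/-- A state is transient if the chain started there has positive probability of never returning. -/
def IsTransient (P : S → PMF S) (s : S) : Prop :=
  returnProb P s < 1

/-- A state is positive recurrent if the chain started there returns with probability one and
the mean return time is finite. -/
def IsPositiveRecurrent (P : S → PMF S) (s : S) : Prop :=
  returnProb P s = 1 ∧ ∑' n : ℕ, (n : ℝ≥0∞) * firstPassage P s n s < ∞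

/-- A state is aperiodic if the greatest common divisor of its possible return times is one. -/
def IsAperiodic (P : S → PMF S) (s : S) : Prop :=
  Nat.setGcd {n : ℕ | 0 < n ∧ 0 < nStep P n s s} = 1

/-- `t` can be reached from `s` in some number `n ≥ 0` of steps. -/
def Accessible (P : S → PMF S) (s t : S) : Prop :=
  ∃ n, 0 < nStep P n s t

/-- The communicating class of `s`: the states `t` that are accessible from `s` and from which `s`
is accessible. -/
def communicatingClass (P : S → PMF S) (s : S) : Set S :=
  {t | Accessible P s t ∧ Accessible P t s}

/-- `π` is a stationary distribution: a chain with initial law `π` has law `π` after one step. -/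
def IsStationary (P : S → PMF S) (π : PMF S) : Prop :=
  π.bind P = π

end DiscreteChain

/-! ## The TCP CUBIC chain -/

namespace TCPCubic

/-- The CUBIC window function with parameters `C`, `β`, at real time `t` after a loss that happened
when the window was `w₀`. -/
noncomputable def cubic (C β w₀ t : ℝ) : ℝ :=
  C * (t - (β * w₀ / C) ^ (1 / 3 : ℝ)) ^ 3 + w₀

/-- The window size, in packets, `d` round trip times (each of length `R`) after a loss that
happened when the window was `z`: the integer part of the CUBIC window, and at least one packet. -/
noncomputable def window (C β R : ℝ) (z : ℕ+) (d : ℕ) : ℕ+ :=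
  ⟨max 1 ⌊cubic C β z (R * d)⌋₊, lt_max_of_lt_left one_pos⟩

/-- The probability that none of `w` packets is lost, when each is lost independently with
probability `p`. -/
def noLossProb (p : ℝ) (hp : 0 < p ∧ p < 1) (w : ℕ) : ℝ≥0 :=
  ⟨(1 - p) ^ w, pow_nonneg (by linarith [hp.2]) w⟩

theorem noLossProb_le_one (p : ℝ) (hp : 0 < p ∧ p < 1) (w : ℕ) : noLossProb p hp w ≤ 1 :=
  pow_le_one₀ (by linarith [hp.2] : (0 : ℝ) ≤ 1 - p) (by linarith [hp.1])

/-- The transition law of `(W', T)`. In state `(z, d)` the last loss happened `d` round trip times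
ago at window size `z`, so the current window is `w = window C β R z d`. If none of the `w` packets
is lost the next state is `(z, d + 1)`; otherwise there is a loss at window size `w` and the next
state is `(w, 0)`. -/
noncomputable def step (C β R p : ℝ) (hp : 0 < p ∧ p < 1) (s : ℕ+ × ℕ) : PMF (ℕ+ × ℕ) :=
  (PMF.bernoulli (noLossProb p hp (window C β R s.1 s.2)) (noLossProb_le_one p hp _)).map
    fun noLoss => if noLoss then (s.1, s.2 + 1) else (window C β R s.1 s.2, 0)

end TCPCubic

/-! ### Accessibility and periodicity -/

namespace DiscreteChain

variable {S : Type*}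

/-! Everything follows from one state, `(1, 0)`. A loss always has positive probability, and at age
`0` it strictly decreases any window above `1` (`window_zero_lt`), so repeated losses lead from
every state to `(1, 0)`, where a further loss is a self-loop. A state outside the class of `(1, 0)`
therefore reaches a state from which it cannot return, and is transient.

Positive recurrence is Foster's criterion with an explicit Lyapunov function
(`exists_potential_drift`). At positive age the window may have grown by up to `C * R ^ 3 * d ^ 3`;
a cubic age cost pays for this, since each step loses a packet with probability at least `p`. At age
`0` the loss shrinks the window by about the factor `1 - β`, while failing to lose is exponentially
unlikely for large windows; a bounded correction handles small windows.

Positive recurrence passes to the whole class by transporting Lyapunov functions along transitions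
(`IsLyapunov.exists_of_pos`). The stationary law is the normalized occupation measure of an
excursion from `(1, 0)`, and every stationary law is a multiple of it (`eq_mul_excursionMeasure`).
-/

theorem nStep_succ_apply (P : S → PMF S) (n : ℕ) (s t : S) :
    nStep P (n + 1) s t = ∑' u, P s u * nStep P n u t := rfl

theorem nStep_zero_self_pos (P : S → PMF S) (s : S) : 0 < nStep P 0 s s := by
  simp [nStep]

theorem nStep_succ_pos {P : S → PMF S} {n : ℕ} {s u t : S} (h : 0 < P s u)
    (h' : 0 < nStep P n u t) : 0 < nStep P (n + 1) s t :=
  (ENNReal.mul_pos h.ne' h'.ne').trans_le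
    (ENNReal.le_tsum (f := fun u => P s u * nStep P n u t) u)

theorem exists_of_nStep_succ_pos {P : S → PMF S} {n : ℕ} {s t : S}
    (h : 0 < nStep P (n + 1) s t) : ∃ u, 0 < P s u ∧ 0 < nStep P n u t := by
  by_contra! hc
  refine h.ne' ?_
  rw [nStep_succ_apply, ENNReal.tsum_eq_zero]
  intro u
  rcases eq_or_ne (P s u) 0 with h0 | h0
  · simp [h0]
  · simp [nonpos_iff_eq_zero.1 (hc u (pos_iff_ne_zero.2 h0))]

theorem nStep_add_pos {P : S → PMF S} {m n : ℕ} {s u t : S} (h : 0 < nStep P m s u)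
    (h' : 0 < nStep P n u t) : 0 < nStep P (m + n) s t := by
  induction m generalizing s with
  | zero =>
    have : u = s := by
      by_contra hne
      simp [nStep, PMF.pure_apply, hne] at h
    subst this
    simpa using h'
  | succ m ih =>
    obtain ⟨v, hv, hv'⟩ := exists_of_nStep_succ_pos h
    rw [Nat.add_right_comm]
    exact nStep_succ_pos hv (ih hv')

theorem nStep_one_pos {P : S → PMF S} {s t : S} (h : 0 < P s t) : 0 < nStep P 1 s t :=
  nStep_succ_pos h (nStep_zero_self_pos P t)

theorem Accessible.refl (P : S → PMF S) (s : S) : Accessible P s s :=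
  ⟨0, nStep_zero_self_pos P s⟩

theorem Accessible.trans {P : S → PMF S} {s u t : S} (h : Accessible P s u)
    (h' : Accessible P u t) : Accessible P s t :=
  let ⟨m, hm⟩ := h
  let ⟨n, hn⟩ := h'
  ⟨m + n, nStep_add_pos hm hn⟩

theorem Accessible.of_pos {P : S → PMF S} {s t : S} (h : 0 < P s t) : Accessible P s t :=
  ⟨1, nStep_one_pos h⟩

/-- A property that is preserved by possible transitions is preserved by accessibility. -/
theorem Accessible.induction {P : S → PMF S} {p : S → Prop}
    (hp : ∀ u v, p u → 0 < P u v → p v) {s t : S} (h : Accessible P s t) (hs : p s) : p t := by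
  obtain ⟨n, hn⟩ := h
  induction n generalizing s with
  | zero =>
    have : t = s := by
      by_contra hne
      simp [nStep, PMF.pure_apply, hne] at hn
    exact this ▸ hs
  | succ n ih =>
    obtain ⟨v, hv, hv'⟩ := exists_of_nStep_succ_pos hn
    exact ih (hp s v hs hv) hv'

/-- Traversing the loop at `o` once or twice gives two return times to `s` that differ by one. -/
theorem isAperiodic_of_accessible_loop {P : S → PMF S} {s o : S} (hso : Accessible P s o)
    (hos : Accessible P o s) (ho : 0 < P o o) : IsAperiodic P s := by
  obtain ⟨a, ha⟩ := hso
  obtain ⟨b, hb⟩ := hos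
  have h1 := nStep_add_pos ha (nStep_add_pos (nStep_one_pos ho) hb)
  have h2 := nStep_add_pos ha
    (nStep_add_pos (nStep_one_pos ho) (nStep_add_pos (nStep_one_pos ho) hb))
  have d1 := Nat.setGcd_dvd_of_mem (s := {n : ℕ | 0 < n ∧ 0 < nStep P n s s})
    (n := a + (1 + b)) ⟨by omega, h1⟩
  have d2 := Nat.setGcd_dvd_of_mem (s := {n : ℕ | 0 < n ∧ 0 < nStep P n s s})
    (n := a + (1 + (1 + b))) ⟨by omega, h2⟩
  have d3 := Nat.dvd_sub d2 d1
  have e : a + (1 + (1 + b)) - (a + (1 + b)) = 1 := by omega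
  rw [e] at d3
  exact Nat.dvd_one.1 d3

/-! ### Survival probabilities and first passage times -/

open Classical in
/-- `survival P t n s` is the probability that the chain started in `s` is not in `t` at any of
the times `1, …, n`. -/
noncomputable def survival (P : S → PMF S) (t : S) : ℕ → S → ℝ≥0∞
  | 0, _ => 1
  | n + 1, s => ∑' u, if u = t then 0 else P s u * survival P t n u

theorem survival_eq_firstPassage_add (P : S → PMF S) (t : S) (n : ℕ) (s : S) :
    survival P t n s = firstPassage P t (n + 1) s + survival P t (n + 1) s := by
  classical
  induction n generalizing s with
  | zero =>
    simp only [survival, firstPassage, mul_one]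
    rw [← ENNReal.tsum_eq_add_tsum_ite (f := fun u => P s u), (P s).tsum_coe]
  | succ n ih =>
    rw [survival, firstPassage, survival, ← ENNReal.tsum_add]
    refine tsum_congr fun u => ?_
    split_ifs
    · simp
    · rw [← mul_add, ← ih]

theorem sum_firstPassage_add_survival (P : S → PMF S) (t : S) (n : ℕ) (s : S) :
    ∑ k ∈ Finset.range n, firstPassage P t (k + 1) s + survival P t n s = 1 := by
  induction n with
  | zero => simp [survival]
  | succ n ih => rw [Finset.sum_range_succ, add_assoc, ← survival_eq_firstPassage_add, ih]

theorem tsum_firstPassage_le_one (P : S → PMF S) (t s : S) :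
    ∑' n, firstPassage P t n s ≤ 1 := by
  rw [tsum_eq_zero_add' ENNReal.summable, firstPassage, zero_add]
  refine ENNReal.tsum_le_of_sum_range_le fun n => ?_
  rw [← sum_firstPassage_add_survival P t n s]
  exact le_self_add

open Classical in
/-- First step analysis of the probability of ever visiting `t`. -/
theorem tsum_firstPassage_eq (P : S → PMF S) (t s : S) :
    ∑' n, firstPassage P t n s =
      ∑' u, P s u * if u = t then 1 else ∑' n, firstPassage P t n u := by
  have h (u : S) : ∑' n, firstPassage P t n u = ∑' n, firstPassage P t (n + 1) u := by
    rw [tsum_eq_zero_add' ENNReal.summable, firstPassage, zero_add]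
  rw [h, tsum_eq_zero_add' ENNReal.summable]
  simp only [firstPassage]
  rw [ENNReal.tsum_comm, ENNReal.tsum_eq_add_tsum_ite
    (f := fun u => P s u * if u = t then 1 else ∑' n, firstPassage P t n u) t, if_pos rfl, mul_one]
  congr 1
  refine tsum_congr fun u => ?_
  split_ifs with hu
  · simp
  · rw [ENNReal.tsum_mul_left, h]

theorem accessible_of_firstPassage_ne_zero {P : S → PMF S} {t s : S} {n : ℕ}
    (h : firstPassage P t n s ≠ 0) : Accessible P s t := by
  classical
  induction n generalizing s with
  | zero => exact absurd rfl h
  | succ n ih =>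
    cases n with
    | zero => exact .of_pos (pos_iff_ne_zero.2 h)
    | succ n =>
      rw [firstPassage] at h
      obtain ⟨u, hu⟩ := not_forall.1 (mt ENNReal.tsum_eq_zero.2 h)
      split_ifs at hu with hut
      · exact absurd rfl hu
      · exact (Accessible.of_pos (pos_iff_ne_zero.2 (left_ne_zero_of_mul hu))).trans
          (ih (right_ne_zero_of_mul hu))

theorem eq_one_of_tsum_mul_eq_one (p : PMF S) {f : S → ℝ≥0∞} (hf : ∀ u, f u ≤ 1)
    (h : ∑' u, p u * f u = 1) {u : S} (hu : 0 < p u) : f u = 1 := by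
  by_contra hne
  have hlt : f u < 1 := lt_of_le_of_ne (hf u) hne
  have := ENNReal.tsum_lt_tsum (f := fun u => p u * f u) (g := p) (i := u) (by simp [h])
    (fun v => mul_le_of_le_one_right' (hf v))
    (by simpa using (ENNReal.mul_lt_mul_iff_right hu.ne' (p.apply_ne_top u)).2 hlt)
  rw [h, p.tsum_coe] at this
  exact lt_irrefl _ this

/-- A state from which some state is accessible that does not lead back is transient. -/
theorem isTransient_of_not_accessible {P : S → PMF S} {s o : S} (hso : Accessible P s o)
    (hos : ¬ Accessible P o s) : IsTransient P s := by
  classical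
  by_contra hs
  have hs1 : ∑' n, firstPassage P s n s = 1 :=
    le_antisymm (tsum_firstPassage_le_one P s s) (not_lt.1 hs)
  have ho : ∑' n, firstPassage P s n o = 1 := by
    -- Probability one of hitting `s` is an average of quantities at most one, so it is inherited by
    -- every possible successor.
    refine hso.induction (p := fun u => ∑' n, firstPassage P s n u = 1) ?_ hs1
    intro u v hu huv
    rw [tsum_firstPassage_eq] at hu
    have hv := eq_one_of_tsum_mul_eq_one (P u) (fun w => ?_) hu huv
    · split_ifs at hv with h
      · rwa [h]
      · exact hv
    · split_ifs
      · exact le_rfl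
      · exact tsum_firstPassage_le_one P s w
  have : ¬ ∀ n, firstPassage P s n o = 0 := fun h => by simp [h] at ho
  obtain ⟨n, hn⟩ := not_forall.1 this
  exact hos (accessible_of_firstPassage_ne_zero hn)

/-! ### The Foster criterion -/

/-- `V` is a Lyapunov function for `o`: it is finite, decreases by at least one in mean in each
step from a state other than `o`, and has finite mean after one step from `o`. -/
structure IsLyapunov (P : S → PMF S) (o : S) (V : S → ℝ≥0∞) : Prop where
  ne_top : ∀ s, V s ≠ ∞
  mean_ne_top : ∑' u, P o u * V u ≠ ∞
  drift : ∀ s, s ≠ o → ∑' u, P s u * V u + 1 ≤ V s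

/-- Away from `o` each step consumes at least one unit of `V`, so the mean time to hit `o` from `u ≠
o` is at most `V u`; one unconstrained first step gives the bound for every start. -/
theorem sum_survival_le {P : S → PMF S} {o : S} {V : S → ℝ≥0∞} (hV : IsLyapunov P o V) (N : ℕ)
    (s : S) : ∑ n ∈ Finset.range N, survival P o n s ≤ ∑' u, P s u * V u + 1 := by
  classical
  induction N generalizing s with
  | zero => simp
  | succ N ih =>
    rw [Finset.sum_range_succ']
    gcongr
    · simp only [survival]
      rw [← Summable.tsum_finsetSum fun _ _ => ENNReal.summable]
      refine ENNReal.tsum_le_tsum fun u => ?_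
      split_ifs with hu
      · simp
      · rw [← Finset.mul_sum]
        gcongr
        exact (ih u).trans (hV.drift u hu)
    · exact le_rfl

theorem IsLyapunov.tsum_survival_ne_top {P : S → PMF S} {o : S} {V : S → ℝ≥0∞}
    (hV : IsLyapunov P o V) : ∑' n, survival P o n o ≠ ∞ :=
  ne_top_of_le_ne_top (ENNReal.add_ne_top.2 ⟨hV.mean_ne_top, ENNReal.one_ne_top⟩)
    (ENNReal.tsum_le_of_sum_range_le fun N => sum_survival_le hV N o)

theorem tsum_firstPassage_add_le_survival (P : S → PMF S) (t s : S) (n : ℕ) :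
    ∑' k, firstPassage P t (k + n + 1) s ≤ survival P t n s := by
  refine ENNReal.tsum_le_of_sum_range_le fun N => ?_
  suffices ∑ k ∈ Finset.range N, firstPassage P t (k + n + 1) s + survival P t (N + n) s
      = survival P t n s from le_self_add.trans this.le
  induction N with
  | zero => simp
  | succ N ih =>
    rw [Finset.sum_range_succ, add_assoc, Nat.add_right_comm N 1 n,
      ← survival_eq_firstPassage_add, ih]

theorem tsum_nat_mul_eq (f : ℕ → ℝ≥0∞) :
    ∑' n : ℕ, (n : ℝ≥0∞) * f n = ∑' k : ℕ, ∑' n : ℕ, f (n + k + 1) := by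
  have h (k : ℕ) : ∑' n : ℕ, f (n + k + 1) = ∑' n : ℕ, if k < n then f n else 0 := by
    rw [← Summable.sum_add_tsum_nat_add' (k := k + 1)
      (f := fun n => if k < n then f n else 0) ENNReal.summable,
      Finset.sum_eq_zero, zero_add]
    · refine tsum_congr fun n => ?_
      rw [if_pos (by omega), add_assoc]
    · intro n hn
      rw [if_neg]
      have := Finset.mem_range.1 hn
      omega
  simp_rw [h]
  rw [ENNReal.tsum_comm]
  refine tsum_congr fun n => ?_
  rw [tsum_eq_sum (s := Finset.range n)]
  · rw [Finset.sum_congr rfl fun k hk => if_pos (Finset.mem_range.1 hk)]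
    simp
  · intro k hk
    rw [if_neg (by simpa using hk)]

/-- Foster's criterion. -/
theorem IsLyapunov.isPositiveRecurrent {P : S → PMF S} {o : S} {V : S → ℝ≥0∞}
    (hV : IsLyapunov P o V) : IsPositiveRecurrent P o := by
  have hfin := hV.tsum_survival_ne_top
  constructor
  · have h0 := ENNReal.tendsto_atTop_zero_of_tsum_ne_top hfin
    have h1 : Filter.Tendsto (fun n => ∑ k ∈ Finset.range n, firstPassage P o (k + 1) o)
        Filter.atTop (nhds (∑' k, firstPassage P o (k + 1) o)) :=
      ENNReal.summable.hasSum.tendsto_sum_nat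
    have h2 := h1.add h0
    simp only [sum_firstPassage_add_survival, add_zero] at h2
    rw [returnProb, tsum_eq_zero_add' ENNReal.summable, firstPassage, zero_add]
    exact tendsto_nhds_unique h2 tendsto_const_nhds
  · rw [tsum_nat_mul_eq]
    exact (ENNReal.tsum_le_tsum fun n => tsum_firstPassage_add_le_survival P o o n).trans_lt
      hfin.lt_top

/-- Raise `V` by a constant `K` off `s` and set it to `0` at `s`. The drift away from `o` is
unaffected, and at `o` the chance of jumping to `s` saves `P o s * K`, which is chosen to cover the
mean of `V` after the step plus one. -/
theorem IsLyapunov.exists_of_pos {P : S → PMF S} {o s : S} (ho : ∃ V, IsLyapunov P o V)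
    (h : 0 < P o s) : ∃ V, IsLyapunov P s V := by
  classical
  obtain ⟨V, hV⟩ := ho
  rcases eq_or_ne s o with rfl | hne
  · exact ⟨V, hV⟩
  set M : ℝ≥0∞ := ∑' u, P o u * V u + 1 with hM
  have hMtop : M ≠ ∞ := ENNReal.add_ne_top.2 ⟨hV.mean_ne_top, ENNReal.one_ne_top⟩
  set K : ℝ≥0∞ := M / P o s with hK
  have hKtop : K ≠ ∞ := ENNReal.div_ne_top hMtop h.ne'
  have hKM : P o s * K = M := ENNReal.mul_div_cancel h.ne' (PMF.apply_ne_top _ _)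
  have key (v : S) : ∑' u, P v u * (if u = s then 0 else V u + K) + P v s * K
      ≤ ∑' u, P v u * V u + K := by
    calc _ ≤ ∑' u, P v u * (if u = s then 0 else V u + K)
          + ∑' u, P v u * (if u = s then K else 0) := by
          gcongr
          refine le_trans (by simp) (ENNReal.le_tsum s)
      _ = ∑' u, P v u * (if u = s then K else V u + K) := by
          rw [← ENNReal.tsum_add]
          refine tsum_congr fun u => ?_
          split_ifs <;> simp
      _ ≤ ∑' u, P v u * (V u + K) := by
          gcongr with u
          split_ifs
          · exact le_add_self
          · exact le_rfl
      _ = _ := by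
          simp_rw [mul_add]
          rw [ENNReal.tsum_add, ENNReal.tsum_mul_right, (P v).tsum_coe, one_mul]
  refine ⟨fun u => if u = s then 0 else V u + K, ?_, ?_, ?_⟩
  · intro u
    split_ifs
    · simp
    · exact ENNReal.add_ne_top.2 ⟨hV.ne_top u, hKtop⟩
  · refine ne_top_of_le_ne_top ?_ (le_self_add.trans (key s))
    exact ENNReal.add_ne_top.2 ⟨ne_top_of_le_ne_top (hV.ne_top s)
      (le_self_add.trans (hV.drift s hne)), hKtop⟩
  · intro v hv
    rw [if_neg hv]
    rcases eq_or_ne v o with rfl | hvo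
    · have := key v
      rw [hKM, hM, ← add_assoc, add_right_comm, add_comm (∑' u, P v u * V u) K] at this
      exact (ENNReal.le_of_add_le_add_right hV.mean_ne_top this).trans le_add_self
    · calc _ ≤ ∑' u, P v u * V u + K + 1 := by
            gcongr
            exact le_self_add.trans (key v)
        _ = ∑' u, P v u * V u + 1 + K := add_right_comm _ _ _
        _ ≤ _ := by
            gcongr
            exact hV.drift v hvo

theorem isPositiveRecurrent_of_accessible {P : S → PMF S} {o s : S} {V : S → ℝ≥0∞}
    (hV : IsLyapunov P o V) (h : Accessible P o s) : IsPositiveRecurrent P s :=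
  let ⟨_, hW⟩ := h.induction (p := fun u => ∃ V, IsLyapunov P u V)
    (fun _ _ => IsLyapunov.exists_of_pos) ⟨V, hV⟩
  hW.isPositiveRecurrent

end DiscreteChain

namespace DiscreteChain

variable {S : Type*}

/-! ### Stationary distributions -/

open Classical in
/-- `taboo P o n u` is the probability that the chain started in `o` is in `u` at time `n` and not
in `o` at any of the times `1, …, n`. -/
noncomputable def taboo (P : S → PMF S) (o : S) : ℕ → S → ℝ≥0∞
  | 0, u => if u = o then 1 else 0
  | n + 1, u => if u = o then 0 else ∑' v, taboo P o n v * P v u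

/-- The expected number of visits to a state during an excursion from `o`. -/
noncomputable def excursionMeasure (P : S → PMF S) (o u : S) : ℝ≥0∞ :=
  ∑' n, taboo P o n u

/-- Both sides weigh the paths from `o` that avoid `o` for `n + 1 + m` steps, cut at time `n + 1` or
at time `n`. -/
theorem tsum_taboo_mul_survival (P : S → PMF S) (o : S) (n m : ℕ) :
    ∑' u, taboo P o (n + 1) u * survival P o m u = ∑' u, taboo P o n u * survival P o (m + 1) u := by
  classical
  simp only [taboo, survival]
  simp_rw [← ENNReal.tsum_mul_left]
  rw [ENNReal.tsum_comm]
  refine tsum_congr fun u => ?_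
  split_ifs with h
  · simp
  · rw [← ENNReal.tsum_mul_right]
    exact tsum_congr fun v => mul_assoc _ _ _

theorem tsum_taboo (P : S → PMF S) (o : S) (n : ℕ) :
    ∑' u, taboo P o n u = survival P o n o := by
  classical
  suffices ∀ m, ∑' u, taboo P o n u * survival P o m u = survival P o (n + m) o by
    simpa [survival] using this 0
  induction n with
  | zero =>
    intro m
    simp [taboo]
  | succ n ih =>
    intro m
    rw [tsum_taboo_mul_survival, ih, Nat.add_right_comm, add_assoc]

theorem excursionMeasure_self (P : S → PMF S) (o : S) : excursionMeasure P o o = 1 := by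
  rw [excursionMeasure, tsum_eq_zero_add' ENNReal.summable]
  simp [taboo]

theorem tsum_excursionMeasure (P : S → PMF S) (o : S) :
    ∑' u, excursionMeasure P o u = ∑' n, survival P o n o := by
  simp only [excursionMeasure]
  rw [ENNReal.tsum_comm]
  exact tsum_congr fun n => tsum_taboo P o n

theorem excursionMeasure_mul_of_ne (P : S → PMF S) {o u : S} (h : u ≠ o) :
    ∑' v, excursionMeasure P o v * P v u = excursionMeasure P o u := by
  conv_rhs => rw [excursionMeasure, tsum_eq_zero_add' ENNReal.summable]
  simp only [taboo, if_neg h, zero_add, excursionMeasure]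
  rw [ENNReal.tsum_comm]
  exact tsum_congr fun v => ENNReal.tsum_mul_right.symm

/-- At `o` itself invariance follows by conservation of mass: the totals agree and so do all other
coordinates, and finiteness permits cancellation. -/
theorem excursionMeasure_mul {P : S → PMF S} {o : S} (hfin : ∑' n, survival P o n o ≠ ∞) (u : S) :
    ∑' v, excursionMeasure P o v * P v u = excursionMeasure P o u := by
  classical
  rcases eq_or_ne u o with rfl | h
  · have h1 : ∑' w, ∑' v, excursionMeasure P u v * P v w = ∑' w, excursionMeasure P u w := by
      rw [ENNReal.tsum_comm]
      refine tsum_congr fun v => ?_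
      rw [ENNReal.tsum_mul_left, (P v).tsum_coe, mul_one]
    rw [← tsum_excursionMeasure] at hfin
    rw [ENNReal.tsum_eq_add_tsum_ite (f := fun w => ∑' v, excursionMeasure P u v * P v w) u,
      ENNReal.tsum_eq_add_tsum_ite (f := excursionMeasure P u) u] at h1
    have h2 : (∑' w, if w = u then 0 else ∑' v, excursionMeasure P u v * P v w)
        = ∑' w, if w = u then 0 else excursionMeasure P u w := by
      refine tsum_congr fun w => ?_
      split_ifs with hw
      · rfl
      · exact excursionMeasure_mul_of_ne P hw
    rw [h2] at h1
    refine (ENNReal.add_left_inj (ne_top_of_le_ne_top hfin ?_)).1 h1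
    rw [ENNReal.tsum_eq_add_tsum_ite (f := excursionMeasure P u) u]
    exact le_add_self
  · exact excursionMeasure_mul_of_ne P h

/-- Unrolling invariance backwards splits `π u` by the last visit to `o`; the truncated sums account
for only part of the mass. -/
theorem mul_excursionMeasure_le {P : S → PMF S} {π : S → ℝ≥0∞}
    (hπ : ∀ u, ∑' v, π v * P v u = π u) (o u : S) : π o * excursionMeasure P o u ≤ π u := by
  classical
  rw [excursionMeasure, ← ENNReal.tsum_mul_left]
  refine ENNReal.tsum_le_of_sum_range_le fun N => ?_
  induction N generalizing u with
  | zero => simp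
  | succ N ih =>
    rw [Finset.sum_range_succ']
    rcases eq_or_ne u o with rfl | h
    · simp [taboo]
    · simp only [taboo, if_neg h, mul_zero, add_zero]
      conv_rhs => rw [← hπ u]
      simp_rw [← ENNReal.tsum_mul_left]
      rw [← Summable.tsum_finsetSum fun _ _ => ENNReal.summable]
      refine ENNReal.tsum_le_tsum fun v => ?_
      simp_rw [← mul_assoc]
      rw [← Finset.sum_mul]
      gcongr
      exact ih v

theorem tsum_mul_nStep {P : S → PMF S} {l : S → ℝ≥0∞}
    (hl : ∀ u, ∑' v, l v * P v u = l u) (n : ℕ) (t : S) :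
    ∑' v, l v * nStep P n v t = l t := by
  classical
  induction n with
  | zero => simp [nStep, PMF.pure_apply]
  | succ n ih =>
    simp_rw [nStep_succ_apply, ← ENNReal.tsum_mul_left]
    rw [ENNReal.tsum_comm]
    simp_rw [← mul_assoc, ENNReal.tsum_mul_right, hl]
    exact ih

/-- The difference is a nonnegative invariant measure vanishing at `o`; mass at any `u` would flow
to `o` with positive probability. -/
theorem eq_mul_excursionMeasure {P : S → PMF S} {o : S} (hacc : ∀ s, Accessible P s o)
    (hfin : ∑' n, survival P o n o ≠ ∞) {π : PMF S} (hπ : IsStationary P π) (u : S) :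
    π u = π o * excursionMeasure P o u := by
  have hπ' (u : S) : ∑' v, π v * P v u = π u := by
    conv_rhs => rw [← hπ]
    rfl
  set l : S → ℝ≥0∞ := fun u => π u - π o * excursionMeasure P o u with hl
  have hadd (u : S) : π o * excursionMeasure P o u + l u = π u :=
    add_tsub_cancel_of_le (mul_excursionMeasure_le hπ' o u)
  have htop (u : S) : π o * excursionMeasure P o u ≠ ∞ :=
    ne_top_of_le_ne_top (π.apply_ne_top u) (mul_excursionMeasure_le hπ' o u)
  have hinv (u : S) : ∑' v, l v * P v u = l u := by
    refine (ENNReal.add_right_inj (htop u)).1 ?_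
    rw [hadd, ← hπ' u]
    conv_lhs => rw [← excursionMeasure_mul hfin u, ← ENNReal.tsum_mul_left, ← ENNReal.tsum_add]
    refine tsum_congr fun v => ?_
    rw [← hadd v, add_mul, mul_assoc]
  have hlo : l o = 0 := by simp [hl, excursionMeasure_self]
  obtain ⟨n, hn⟩ := hacc u
  have h0 := tsum_mul_nStep hinv n o
  rw [hlo, ENNReal.tsum_eq_zero] at h0
  have hlu : l u = 0 := (mul_eq_zero.1 (h0 u)).resolve_right hn.ne'
  rw [← hadd u, hlu, add_zero]

theorem existsUnique_isStationary {P : S → PMF S} {o : S} (hacc : ∀ s, Accessible P s o)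
    (hfin : ∑' n, survival P o n o ≠ ∞) : ∃! π : PMF S, IsStationary P π := by
  have hm := tsum_excursionMeasure P o
  have h0 : ∑' u, excursionMeasure P o u ≠ 0 := fun h => by
    simpa [excursionMeasure_self] using ENNReal.tsum_eq_zero.1 h o
  rw [← hm] at hfin
  refine ⟨PMF.normalize (excursionMeasure P o) h0 hfin, ?_, ?_⟩
  · ext u
    rw [PMF.bind_apply]
    simp only [PMF.normalize_apply]
    simp_rw [mul_right_comm _ (_⁻¹)]
    rw [ENNReal.tsum_mul_right, excursionMeasure_mul (hm ▸ hfin)]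
  · intro π hπ
    have h := eq_mul_excursionMeasure hacc (hm ▸ hfin) hπ
    have h1 : π o * ∑' u, excursionMeasure P o u = 1 := by
      rw [← ENNReal.tsum_mul_left, ← π.tsum_coe]
      exact tsum_congr fun u => (h u).symm
    ext u
    rw [PMF.normalize_apply, h u, ENNReal.eq_inv_of_mul_eq_one_left h1, mul_comm]

/-- A chain with a Lyapunov function for a state `o` with a self-loop that is accessible from
everywhere has exactly one positive recurrent aperiodic class, all other states are transient, and
there is exactly one stationary distribution. -/
theorem IsLyapunov.existsUnique_class {P : S → PMF S} {o : S} {V : S → ℝ≥0∞}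
    (hV : IsLyapunov P o V) (hacc : ∀ s, Accessible P s o) (ho : 0 < P o o) :
    ∃! K : Set S, (∃ s, K = communicatingClass P s) ∧
      (∀ s ∈ K, IsPositiveRecurrent P s ∧ IsAperiodic P s) ∧ ∀ s ∉ K, IsTransient P s := by
  have hrec (s : S) (hs : s ∈ communicatingClass P o) :
      IsPositiveRecurrent P s ∧ IsAperiodic P s :=
    ⟨isPositiveRecurrent_of_accessible hV hs.1, isAperiodic_of_accessible_loop hs.2 hs.1 ho⟩
  have htrans (s : S) (hs : s ∉ communicatingClass P o) : IsTransient P s :=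
    isTransient_of_not_accessible (hacc s) fun h => hs ⟨h, hacc s⟩
  refine ⟨communicatingClass P o, ⟨⟨o, rfl⟩, hrec, htrans⟩, ?_⟩
  rintro K ⟨-, hK, hK'⟩
  ext s
  constructor
  · intro hs
    by_contra h
    exact (htrans s h).ne (hK s hs).1.1
  · intro hs
    by_contra h
    exact (hK' s h).ne (hrec s hs).1.1

end DiscreteChain

namespace TCPCubic

/-! ### The window function -/

theorem cubic_zero {C β w₀ : ℝ} (hC : 0 < C) (hβ : 0 ≤ β) (hw : 0 ≤ w₀) :
    cubic C β w₀ 0 = (1 - β) * w₀ := by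
  have h : ((β * w₀ / C) ^ (1 / 3 : ℝ)) ^ 3 = β * w₀ / C := by
    rw [← Real.rpow_natCast, ← Real.rpow_mul (by positivity)]
    norm_num
  rw [cubic, zero_sub, Odd.neg_pow (by decide), h]
  field_simp
  ring

theorem cubic_le {C β w₀ t : ℝ} (hC : 0 < C) (hβ : 0 ≤ β) (hw : 0 ≤ w₀) :
    cubic C β w₀ t ≤ w₀ + C * t ^ 3 := by
  have h : (t - (β * w₀ / C) ^ (1 / 3 : ℝ)) ^ 3 ≤ t ^ 3 :=
    (Odd.strictMono_pow (by decide : Odd 3)).monotone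
      (sub_le_self _ (Real.rpow_nonneg (by positivity) _))
  rw [cubic, add_comm]
  gcongr

theorem window_le {C β R : ℝ} (hC : 0 < C) (hβ : 0 ≤ β) (hR : 0 ≤ R) (z : ℕ+) (d : ℕ) :
    ((window C β R z d : ℕ) : ℝ) ≤ z + C * R ^ 3 * d ^ 3 := by
  have hz : (1 : ℝ) ≤ (z : ℕ) := Nat.one_le_cast.2 z.pos
  have h := cubic_le (t := R * d) hC hβ (zero_le_one.trans hz)
  have h0 : 0 ≤ C * R ^ 3 * (d : ℝ) ^ 3 := by positivity
  simp only [window, PNat.mk_coe, Nat.cast_max, Nat.cast_one]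
  refine max_le (by linarith) ?_
  rcases le_total 0 (cubic C β z (R * d)) with hc | hc
  · exact (Nat.floor_le hc).trans (h.trans_eq (by ring))
  · rw [Nat.floor_of_nonpos hc, Nat.cast_zero]
    linarith

theorem window_zero {C β R : ℝ} (hC : 0 < C) (hβ : 0 ≤ β) (z : ℕ+) :
    (window C β R z 0 : ℕ) = max 1 ⌊(1 - β) * z⌋₊ := by
  simp only [window, PNat.mk_coe, Nat.cast_zero, mul_zero]
  rw [cubic_zero hC hβ (Nat.cast_nonneg _)]

theorem window_zero_lt {C β R : ℝ} (hC : 0 < C) (hβ : 0 < β) {z : ℕ+} (hz : 1 < z) :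
    window C β R z 0 < z := by
  have hz' : 1 < (z : ℕ) := by exact_mod_cast hz
  rw [← PNat.coe_lt_coe, window_zero hC hβ.le, max_lt_iff]
  refine ⟨hz', ?_⟩
  rw [Nat.floor_lt' (by omega)]
  have : (0 : ℝ) < (z : ℕ) := by positivity
  nlinarith

theorem window_one_zero {C β R : ℝ} (hC : 0 < C) (hβ : 0 < β) : window C β R 1 0 = 1 := by
  rw [← PNat.coe_inj, window_zero hC hβ.le]
  have : ⌊(1 - β) * ((1 : ℕ+) : ℕ)⌋₊ = 0 := Nat.floor_eq_zero.2 (by simpa using hβ)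
  rw [this]
  rfl

theorem lt_window_zero_add_one {C β R : ℝ} (hC : 0 < C) (hβ : 0 ≤ β) (z : ℕ+) :
    (1 - β) * z < (window C β R z 0 : ℕ) + 1 := by
  rw [window_zero hC hβ, Nat.cast_max]
  exact (Nat.lt_floor_add_one _).trans_le (by gcongr; exact le_max_right _ _)

theorem window_zero_le {C β R : ℝ} (hC : 0 < C) (hβ : 0 ≤ β) (hβ1 : β ≤ 1) (z : ℕ+) :
    ((window C β R z 0 : ℕ) : ℝ) ≤ max 1 ((1 - β) * z) := by
  rw [window_zero hC hβ, Nat.cast_max, Nat.cast_one]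
  exact max_le_max le_rfl (Nat.floor_le (mul_nonneg (by linarith) (Nat.cast_nonneg _)))

/-! ### A Lyapunov function -/

/-- The mean of a function after one step. -/
theorem tsum_step_mul (C β R p : ℝ) (hp : 0 < p ∧ p < 1) (s : ℕ+ × ℕ) (f : ℕ+ × ℕ → ℝ≥0∞) :
    ∑' u, step C β R p hp s u * f u =
      ENNReal.ofReal ((1 - p) ^ (window C β R s.1 s.2 : ℕ)) * f (s.1, s.2 + 1) +
      ENNReal.ofReal (1 - (1 - p) ^ (window C β R s.1 s.2 : ℕ)) * f (window C β R s.1 s.2, 0) := by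
  classical
  have h1 : (noLossProb p hp (window C β R s.1 s.2) : ℝ≥0∞)
      = ENNReal.ofReal ((1 - p) ^ (window C β R s.1 s.2 : ℕ)) := by
    rw [← ENNReal.ofReal_coe_nnreal]
    rfl
  simp only [step, PMF.map_apply, tsum_fintype, Fintype.sum_bool, PMF.bernoulli_apply,
    add_mul, ite_mul, zero_mul, cond_true, cond_false, if_true, Bool.false_eq_true, if_false]
  rw [ENNReal.tsum_add, tsum_ite_eq, tsum_ite_eq, ENNReal.coe_sub, ENNReal.coe_one, h1,
    ENNReal.ofReal_sub _ (pow_nonneg (by linarith [hp.2]) _), ENNReal.ofReal_one]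

/-- For such `x` the shift multiplies the cube by at most `1 + p / 2`, and `(1 - p) * (1 + p / 2) ≤
1 - p / 2`. The constant 14 is not optimal. -/
theorem mul_shift_cube_le {p x : ℝ} (hp : 0 < p) (hp1 : p < 1) (hx : 14 / p ≤ x) :
    (1 - p) * (x + 1) ^ 3 ≤ (1 - p / 2) * x ^ 3 := by
  have hx0 : 0 < x := lt_of_lt_of_le (by positivity) hx
  have h1 : x + 1 ≤ (1 + p / 14) * x := by
    rw [div_le_iff₀ hp] at hx
    linarith
  calc (1 - p) * (x + 1) ^ 3 ≤ (1 - p) * ((1 + p / 14) * x) ^ 3 := by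
        have : 0 ≤ 1 - p := by linarith
        gcongr
    _ = (1 - p) * (1 + p / 14) ^ 3 * x ^ 3 := by ring
    _ ≤ _ := by
        gcongr
        have h2 : (1 + p / 14) ^ 3 ≤ 1 + p / 2 := by nlinarith [mul_pos hp hp]
        nlinarith

/-- The part of the Lyapunov function that grows with the time since the last loss. -/
noncomputable def ageCost (p c : ℝ) (d : ℕ) : ℝ := (2 * c + 2 / p) * (d + 14 / p) ^ 3

theorem ageCost_nonneg {p c : ℝ} (hp : 0 < p) (hc : 0 ≤ c) (d : ℕ) : 0 ≤ ageCost p c d := by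
  unfold ageCost
  positivity

theorem cube_le_ageCost {p c : ℝ} (hp : 0 < p) (hp1 : p < 1) (hc : 0 ≤ c) (d : ℕ) :
    2 * c * (d : ℝ) ^ 3 + 2 / p ≤ ageCost p c d := by
  have h14 : 1 ≤ 14 / p := by rw [le_div_iff₀ hp]; linarith
  have h1 : (d : ℝ) ^ 3 ≤ (d + 14 / p) ^ 3 := by gcongr; linarith
  have h2 : 1 ≤ ((d : ℝ) + 14 / p) ^ 3 := one_le_pow₀ (by linarith [Nat.cast_nonneg (α := ℝ) d])
  have h3 : 2 * c * (d : ℝ) ^ 3 ≤ 2 * c * (d + 14 / p) ^ 3 := by gcongr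
  have h4 : 2 / p * 1 ≤ 2 / p * ((d : ℝ) + 14 / p) ^ 3 := by gcongr
  rw [ageCost, add_mul]
  linarith

/-- The left side increases with `r`, so `r = 1 - p` is the worst case; there the decrease `p / 2 *
ageCost p c d` pays for `p * c * d ^ 3` and the unit of drift. -/
theorem ageCost_drift {p c : ℝ} (hp : 0 < p) (hp1 : p < 1) (hc : 0 ≤ c) (d : ℕ) {r : ℝ}
    (hr : r ≤ 1 - p) :
    r * ageCost p c (d + 1) + (1 - r) * (c * (d : ℝ) ^ 3) + 1 ≤ ageCost p c d := by
  have h1 : (1 - p) * ageCost p c (d + 1) ≤ (1 - p / 2) * ageCost p c d := by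
    have := mul_le_mul_of_nonneg_left
      (mul_shift_cube_le hp hp1 (x := d + 14 / p) (by simp)) (by positivity : 0 ≤ 2 * c + 2 / p)
    simp only [ageCost, Nat.cast_add, Nat.cast_one]
    calc _ = (2 * c + 2 / p) * ((1 - p) * (d + 14 / p + 1) ^ 3) := by ring
      _ ≤ _ := this
      _ = _ := by ring
  have h2 := cube_le_ageCost hp hp1 hc d
  have h3 : c * (d : ℝ) ^ 3 ≤ ageCost p c (d + 1) := by
    refine le_trans ?_ (cube_le_ageCost hp hp1 hc (d + 1))
    have : c * (d : ℝ) ^ 3 ≤ c * ((d + 1 : ℕ) : ℝ) ^ 3 := by gcongr; simp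
    have h0 : 0 ≤ c * ((d + 1 : ℕ) : ℝ) ^ 3 := by positivity
    have : 0 ≤ 2 / p := by positivity
    linarith
  have h4 : p / 2 * (2 * c * (d : ℝ) ^ 3 + 2 / p) = p * (c * (d : ℝ) ^ 3) + 1 := by
    field_simp
  have h5 := mul_le_mul_of_nonneg_left h2 (by positivity : 0 ≤ p / 2)
  have h6 := mul_le_mul_of_nonneg_right hr (sub_nonneg.2 h3)
  linarith

theorem pow_mul_le_inv {p : ℝ} (hp : 0 < p) (hp1 : p < 1) (n : ℕ) :
    (1 - p) ^ n * n ≤ 1 / p := by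
  rw [le_div_iff₀ hp]
  have h1 : 1 + n * p ≤ (1 + p) ^ n := one_add_mul_le_pow (by linarith) n
  have h2 : (1 - p) ^ n * (1 + p) ^ n ≤ 1 := by
    rw [← mul_pow]
    exact pow_le_one₀ (by nlinarith) (by nlinarith)
  have h0 : 0 ≤ (1 - p) ^ n := pow_nonneg (by linarith) n
  nlinarith

/-- The Lyapunov inequality at the loss epochs. The bounded term `K * (1 - (p / 2) ^ z)` provides
the drift for the finitely many small windows `z` for which `z` alone does not decrease. -/
theorem exists_lossEpoch_drift {C β p b : ℝ} (R : ℝ) (hC : 0 < C) (hβ : 0 < β ∧ β < 1)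
    (hp : 0 < p) (hp1 : p < 1) (hb : 0 ≤ b) :
    ∃ K : ℝ, 0 ≤ K ∧ ∀ z : ℕ+, 1 < z → ∀ w : ℕ, w = (window C β R z 0 : ℕ) →
      (1 - p) ^ w * (z + b + K) + (1 - (1 - p) ^ w) * (w + K * (1 - (p / 2) ^ w)) + 1
        ≤ z + K * (1 - (p / 2) ^ (z : ℕ)) := by
  have hβ' : 0 < 1 - β := by linarith [hβ.2]
  -- `Q` bounds the mean excess `r * (z - w + b)` when no packet is lost, uniformly in `z`: `z` is
  -- at most `(w + 1) / (1 - β)`, and `r * w ≤ 1 / p`.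
  set Q : ℝ := (1 / p + 1) / (1 - β) + b with hQ
  have hQ0 : 0 ≤ Q := by positivity
  -- From `A` on, the drop from `z` to `w` alone covers `Q + 1`; the two bounds serve the cases `w ≤
  -- (1 - β) * z` and `w ≤ 1`.
  obtain ⟨A, hA⟩ := exists_nat_gt (max ((1 + Q) / β) (2 + Q))
  have hA1 := (le_max_left _ _).trans hA.le
  have hA2 := (le_max_right _ _).trans hA.le
  set K : ℝ := (Q + 1) / (p / 2) ^ A with hK
  have hK0 : 0 ≤ K := by positivity
  refine ⟨K, hK0, fun z hz w hw => ?_⟩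
  have hwz : w + 1 ≤ (z : ℕ) := by
    have := window_zero_lt (R := R) hC hβ.1 hz
    rw [← PNat.coe_lt_coe] at this
    omega
  have hw1 : 1 ≤ w := hw ▸ (window C β R z 0).pos
  have hwzR : (w : ℝ) + 1 ≤ (z : ℕ) := by exact_mod_cast hwz
  have hwlow := lt_window_zero_add_one (R := R) hC hβ.1.le z
  have hwup := window_zero_le (R := R) hC hβ.1.le hβ.2.le z
  rw [← hw] at hwlow hwup
  set r : ℝ := (1 - p) ^ w with hr
  have hr0 : 0 ≤ r := pow_nonneg (by linarith) w
  have hrp : r ≤ 1 - p := pow_le_of_le_one (by linarith) (by linarith) (by omega)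
  have hrw : r * w ≤ 1 / p := pow_mul_le_inv hp hp1 w
  have hrQ : r * (z - w + b) ≤ Q := by
    have hzw : ((z : ℕ) : ℝ) ≤ (w + 1) / (1 - β) := by
      rw [le_div_iff₀ hβ']
      linarith
    have h1 : r * ((w + 1) / (1 - β)) ≤ (1 / p + 1) / (1 - β) := by
      rw [← mul_div_assoc]
      gcongr
      linarith
    have h2 : r * b ≤ b := mul_le_of_le_one_left hb (by linarith)
    have h3 : r * ((z : ℕ) - w + b) ≤ r * ((w + 1) / (1 - β) + b) := by
      gcongr
      linarith [Nat.cast_nonneg (α := ℝ) w]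
    rw [hQ]
    linarith
  -- The base `p / 2` gives `p * (p / 2) ^ w = 2 * (p / 2) ^ (w + 1)`: one copy of `(p / 2) ^ z` is
  -- cancelled and one remains as gain.
  have hθ : (p / 2) ^ (z : ℕ) ≤ (1 - r) * (p / 2) ^ w - (p / 2) ^ (z : ℕ) := by
    have h1 : (p / 2) ^ (z : ℕ) ≤ (p / 2) ^ (w + 1) :=
      pow_le_pow_of_le_one (by positivity) (by linarith) hwz
    have h2 : p * (p / 2) ^ w ≤ (1 - r) * (p / 2) ^ w := by
      gcongr
      linarith
    rw [pow_succ] at h1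
    linarith
  have hθ0 : 0 ≤ (p / 2) ^ (z : ℕ) := by positivity
  have main : w + r * (z - w + b) + 1 ≤ z + K * ((1 - r) * (p / 2) ^ w - (p / 2) ^ (z : ℕ)) := by
    rcases le_total A z with hAz | hAz
    · have h0 : 0 ≤ K * ((1 - r) * (p / 2) ^ w - (p / 2) ^ (z : ℕ)) :=
        mul_nonneg hK0 (hθ0.trans hθ)
      have hAz' : (A : ℝ) ≤ (z : ℕ) := by exact_mod_cast hAz
      have h1 : 1 + Q ≤ β * (z : ℕ) := by
        rw [div_le_iff₀ hβ.1] at hA1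
        nlinarith [hβ.1]
      rcases le_max_iff.1 hwup with h | h <;> linarith
    · have h1 : (p / 2) ^ A ≤ (p / 2) ^ (z : ℕ) :=
        pow_le_pow_of_le_one (by positivity) (by linarith) hAz
      have h2 : Q + 1 = K * (p / 2) ^ A := by
        rw [hK, div_mul_cancel₀]
        positivity
      have h3 := mul_le_mul_of_nonneg_left (h1.trans hθ) hK0
      linarith
  linarith

end TCPCubic

/-! ### Drift of the CUBIC chain and access to `(1, 0)` -/

namespace TCPCubic

/-- The Lyapunov function of the CUBIC chain, with `c = C * R ^ 3`. -/
noncomputable def potential (p c K : ℝ) : ℕ+ × ℕ → ℝ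
  | (z, 0) => z + K * (1 - (p / 2) ^ (z : ℕ))
  | (z, d + 1) => z + ageCost p c (d + 1) + K

theorem potential_nonneg {p c K : ℝ} (hp : 0 < p) (hp1 : p < 1) (hc : 0 ≤ c) (hK : 0 ≤ K)
    (s : ℕ+ × ℕ) : 0 ≤ potential p c K s := by
  obtain ⟨z, _ | d⟩ := s
  · have : 0 ≤ 1 - (p / 2) ^ (z : ℕ) :=
      sub_nonneg.2 (pow_le_one₀ (by positivity) (by linarith))
    simp only [potential]
    positivity
  · have := ageCost_nonneg hp hc (d + 1)
    simp only [potential]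
    positivity

theorem exists_potential_drift {C β R p : ℝ} (hC : 0 < C) (hβ : 0 < β ∧ β < 1) (hR : 0 < R)
    (hp : 0 < p) (hp1 : p < 1) : ∃ K : ℝ, 0 ≤ K ∧ ∀ s : ℕ+ × ℕ, s ≠ (1, 0) →
      (1 - p) ^ (window C β R s.1 s.2 : ℕ) * potential p (C * R ^ 3) K (s.1, s.2 + 1) +
        (1 - (1 - p) ^ (window C β R s.1 s.2 : ℕ)) *
          potential p (C * R ^ 3) K (window C β R s.1 s.2, 0) + 1
        ≤ potential p (C * R ^ 3) K s := by
  have hc : 0 ≤ C * R ^ 3 := by positivity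
  obtain ⟨K, hK, h⟩ := exists_lossEpoch_drift R hC hβ hp hp1 (ageCost_nonneg hp hc 1)
  refine ⟨K, hK, ?_⟩
  rintro ⟨z, _ | d⟩ hs
  · have hz : 1 < z := lt_of_le_of_ne one_le (by rintro rfl; exact hs rfl)
    simpa only [potential] using h z hz _ rfl
  · simp only [potential]
    set w : ℕ := (window C β R z (d + 1) : ℕ) with hw
    have hw0 : w ≠ 0 := (window C β R z (d + 1)).ne_zero
    have hwz : (w : ℝ) ≤ z + C * R ^ 3 * ((d + 1 : ℕ) : ℝ) ^ 3 :=
      window_le hC hβ.1.le hR.le z (d + 1)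
    have hr : (1 - p) ^ w ≤ 1 - p := pow_le_of_le_one (by linarith) (by linarith) hw0
    have h1 := ageCost_drift hp hp1 hc (d + 1) hr
    have h2 : 0 ≤ 1 - (1 - p) ^ w := by linarith
    have h3 := mul_le_mul_of_nonneg_left hwz h2
    -- Positive ages carry the full `K`, so a loss there never increases the bounded term.
    have h4 : 0 ≤ (1 - (1 - p) ^ w) * (K * (p / 2) ^ w) := by positivity
    linarith

theorem exists_isLyapunov {C β R p : ℝ} (hC : 0 < C) (hβ : 0 < β ∧ β < 1) (hR : 0 < R)
    (hp : 0 < p ∧ p < 1) : ∃ V, DiscreteChain.IsLyapunov (step C β R p hp) (1, 0) V := by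
  obtain ⟨K, hK, h⟩ := exists_potential_drift hC hβ hR hp.1 hp.2
  have hV := potential_nonneg hp.1 hp.2 (by positivity : 0 ≤ C * R ^ 3) hK
  refine ⟨fun s => ENNReal.ofReal (potential p (C * R ^ 3) K s), fun s => ENNReal.ofReal_ne_top,
    ?_, fun s hs => ?_⟩
  · rw [tsum_step_mul]
    exact ENNReal.add_ne_top.2 ⟨ENNReal.mul_ne_top ENNReal.ofReal_ne_top ENNReal.ofReal_ne_top,
      ENNReal.mul_ne_top ENNReal.ofReal_ne_top ENNReal.ofReal_ne_top⟩
  · have h0 : 0 ≤ (1 - p) ^ (window C β R s.1 s.2 : ℕ) := pow_nonneg (by linarith [hp.2]) _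
    have h1 : 0 ≤ 1 - (1 - p) ^ (window C β R s.1 s.2 : ℕ) :=
      sub_nonneg.2 (pow_le_one₀ (by linarith [hp.2]) (by linarith [hp.1]))
    rw [tsum_step_mul, ← ENNReal.ofReal_mul h0, ← ENNReal.ofReal_mul h1,
      ← ENNReal.ofReal_add (mul_nonneg h0 (hV _)) (mul_nonneg h1 (hV _)), ← ENNReal.ofReal_one,
      ← ENNReal.ofReal_add (add_nonneg (mul_nonneg h0 (hV _)) (mul_nonneg h1 (hV _))) zero_le_one]
    exact ENNReal.ofReal_le_ofReal (h s hs)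

theorem step_loss_pos (C β R p : ℝ) (hp : 0 < p ∧ p < 1) (s : ℕ+ × ℕ) :
    0 < step C β R p hp s (window C β R s.1 s.2, 0) := by
  classical
  have h := tsum_step_mul C β R p hp s
    (fun u => if u = (window C β R s.1 s.2, 0) then 1 else 0)
  simp only [mul_ite, mul_one, mul_zero, tsum_ite_eq, if_true] at h
  rw [h]
  refine lt_of_lt_of_le (ENNReal.ofReal_pos.2 (sub_pos.2 ?_)) le_add_self
  exact pow_lt_one₀ (by linarith [hp.2]) (by linarith [hp.1]) (PNat.ne_zero _)

theorem accessible_one_zero {C β : ℝ} (R p : ℝ) (hC : 0 < C) (hβ : 0 < β)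
    (hp : 0 < p ∧ p < 1) (s : ℕ+ × ℕ) :
    DiscreteChain.Accessible (step C β R p hp) s (1, 0) := by
  have h (z : ℕ+) : DiscreteChain.Accessible (step C β R p hp) (z, 0) (1, 0) := by
    induction z using PNat.strongInductionOn with
    | _ z ih =>
      rcases eq_or_ne z 1 with rfl | hz
      · exact .refl _ _
      · exact (DiscreteChain.Accessible.of_pos (step_loss_pos C β R p hp (z, 0))).trans
          (ih _ (window_zero_lt hC hβ (lt_of_le_of_ne one_le hz.symm)))
  exact (DiscreteChain.Accessible.of_pos (step_loss_pos C β R p hp s)).trans (h _)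

theorem step_one_zero_self_pos {C β : ℝ} (R p : ℝ) (hC : 0 < C) (hβ : 0 < β)
    (hp : 0 < p ∧ p < 1) : 0 < step C β R p hp (1, 0) (1, 0) := by
  have h := step_loss_pos C β R p hp (1, 0)
  rwa [window_one_zero hC hβ] at h

end TCPCubic

theorem mainTheorem5 (C β R p : ℝ) (hC : 0 < C) (hβ : 0 < β ∧ β < 1) (hR : 0 < R)
    (hp : 0 < p ∧ p < 1) :
    (∃! K : Set (ℕ+ × ℕ),
      (∃ s, K = DiscreteChain.communicatingClass (TCPCubic.step C β R p hp) s) ∧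
      (∀ s ∈ K, DiscreteChain.IsPositiveRecurrent (TCPCubic.step C β R p hp) s ∧
        DiscreteChain.IsAperiodic (TCPCubic.step C β R p hp) s) ∧
      (∀ s ∉ K, DiscreteChain.IsTransient (TCPCubic.step C β R p hp) s)) ∧
    DiscreteChain.IsPositiveRecurrent (TCPCubic.step C β R p hp) (1, 0) ∧
    (∃! π : PMF (ℕ+ × ℕ), DiscreteChain.IsStationary (TCPCubic.step C β R p hp) π) := by
  obtain ⟨V, hV⟩ := TCPCubic.exists_isLyapunov hC hβ hR hp
  have hacc := TCPCubic.accessible_one_zero R p hC hβ.1 hp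
  exact ⟨hV.existsUnique_class hacc (TCPCubic.step_one_zero_self_pos R p hC hβ.1 hp),
    hV.isPositiveRecurrent, DiscreteChain.existsUnique_isStationary hacc hV.tsum_survival_ne_top⟩
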